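/- Let $X$ be a Tychonoff space. Let $A(X)$ be the free abelian topological group over $X$: the abelian topological group containing $X$ as a subspace that generates it, such that every continuous map from $X$ to an abelian topological group $H$ extends uniquely to a continuous homomorphism $A(X)\to H$ (equivalently, the free abelian group on the set $X$ with the finest group topology for which the inclusion of $X$ is continuous). A topological group $G$, written additively, is called $o$-bounded if for every sequence $(U_n)_{n\in\omega}$ of nonempty open subsets of $G$ there is a sequence $(F_n)_{n\in\omega}$ of finite subsets of $G$ with $G=\bigcup_{n\in\omega}(F_n+U_n)$. Let $\mathcal U(X)$ be the universal uniformity of $X$, that is, the largest (finest) uniformity that generates the topology of $X$, and let $\lambda_{\mathcal U(X)}=\{\{U(x):x\in X\}:U\in\mathcal U(X)\}$, where $U(x)=\{y\in X:(x,y)\in U\}$. Then $A(X)$ is $o$-bounded if and only if the multicovered space $(X,\lambda_{\mathcal U(X)})$ has the Scheepers property: for every sequence $(u_n)_{n\in\omega}$ of covers in $\lambda_{\mathcal U(X)}$ there is a sequence $(B_n)_{n\in\omega}$ of subsets of $X$ such that each $B_n$ is contained in the union of a finite subfamily of $u_n$ and every finite subset of $X$ is contained in some $B_n$. -/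

import Mathlib

open scoped Pointwise Uniformity Topology

universe u v

/-! ### The free abelian topological group -/

/-- The topology of the free abelian topological group over `X`: the finest group topology on the
free abelian group generated by `X` for which the inclusion of the generators is continuous. -/
instance freeAbelianGroupTopology (X : Type u) [TopologicalSpace X] :
    TopologicalSpace (FreeAbelianGroup X) :=
  (AddGroupTopology.coinduced (FreeAbelianGroup.of : X → FreeAbelianGroup X)).toTopologicalSpace

instance freeAbelianGroup_isTopologicalAddGroup (X : Type u) [TopologicalSpace X] :
    IsTopologicalAddGroup (FreeAbelianGroup X) :=
  (AddGroupTopology.coinduced (FreeAbelianGroup.of : X → FreeAbelianGroup X)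
    ).toIsTopologicalAddGroup

/-- `FreeAbelianTopGroup X` is the free abelian topological group `A(X)`. -/
abbrev FreeAbelianTopGroup (X : Type u) [TopologicalSpace X] : Type u := FreeAbelianGroup X

theorem continuous_freeAbelianGroup_of (X : Type u) [TopologicalSpace X] :
    Continuous (FreeAbelianGroup.of : X → FreeAbelianTopGroup X) :=
  AddGroupTopology.coinduced_continuous _

/-- The universal property of `A(X)`: every continuous map to an abelian topological group extends
uniquely to a continuous homomorphism. -/
theorem freeAbelianTopGroup_existsUnique_lift (X : Type u) [TopologicalSpace X]
    (H : Type v) [AddCommGroup H] [TopologicalSpace H] [IsTopologicalAddGroup H]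
    (φ : X → H) (hφ : Continuous φ) :
    ∃! ψ : FreeAbelianTopGroup X →+ H, Continuous ψ ∧ ∀ x, ψ (FreeAbelianGroup.of x) = φ x := by
  refine ⟨FreeAbelianGroup.lift φ, ⟨?_, fun x => FreeAbelianGroup.lift_apply_of φ x⟩, ?_⟩
  · let T : AddGroupTopology (FreeAbelianGroup X) :=
      { toTopologicalSpace := TopologicalSpace.induced (FreeAbelianGroup.lift φ) inferInstance
        toIsTopologicalAddGroup := topologicalAddGroup_induced (FreeAbelianGroup.lift φ) }
    have hT : AddGroupTopology.coinduced (FreeAbelianGroup.of : X → FreeAbelianGroup X) ≤ T := by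
      refine sInf_le ?_
      change TopologicalSpace.coinduced _ _ ≤ TopologicalSpace.induced _ _
      rw [← continuous_iff_coinduced_le, continuous_induced_rng]
      convert hφ using 1
      ext x
      simp
    exact continuous_iff_le_induced.2 hT
  · rintro ψ ⟨-, hψ⟩
    ext x
    simp [hψ]

/-- A Tychonoff space `X` is a subspace of `A(X)`. -/
theorem isEmbedding_freeAbelianGroup_of (X : Type u) [TopologicalSpace X] [T35Space X] :
    Topology.IsEmbedding (FreeAbelianGroup.of : X → FreeAbelianTopGroup X) := by
  have hc := continuous_freeAbelianGroup_of X
  refine ⟨⟨le_antisymm hc.le_induced ?_⟩, FreeAbelianGroup.of_injective⟩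
  refine le_of_nhds_le_nhds fun x => ?_
  intro s hs
  obtain ⟨f, hf, hfx, hfs⟩ := CompletelyRegularSpace.completely_regular x (interior s)ᶜ
    isOpen_interior.isClosed_compl (by simpa [mem_interior_iff_mem_nhds] using hs)
  obtain ⟨ψ, ⟨hψ, hψf⟩, -⟩ := freeAbelianTopGroup_existsUnique_lift X ℝ (fun y => (f y : ℝ))
    (continuous_subtype_val.comp hf)
  rw [nhds_induced]
  refine ⟨ψ ⁻¹' Set.Iio 1, (isOpen_Iio.preimage hψ).mem_nhds ?_, fun y hy => ?_⟩
  · simp [hψf, hfx]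
  · by_contra hys
    have h1 := hfs (show y ∈ (interior s)ᶜ from fun h => hys (interior_subset h))
    simp [hψf, h1] at hy

/-- The free abelian topological group over a Tychonoff space is Hausdorff. -/
theorem t2Space_freeAbelianTopGroup (X : Type u) [TopologicalSpace X] [T35Space X] :
    T2Space (FreeAbelianTopGroup X) := by
  classical
  refine ⟨fun a b hab => ?_⟩
  obtain ⟨x, hx⟩ : ∃ x, FreeAbelianGroup.toFinsupp (a - b) x ≠ 0 := by
    by_contra! h
    refine hab (sub_eq_zero.1 ((FreeAbelianGroup.equivFinsupp X).injective ?_))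
    rw [map_zero]
    exact Finsupp.ext h
  set c := FreeAbelianGroup.toFinsupp (a - b) with hc
  obtain ⟨f, hf, hfx, hfs⟩ := CompletelyRegularSpace.completely_regular x
    ((c.support.erase x : Finset X) : Set X) (Finset.finite_toSet _).isClosed (by simp)
  obtain ⟨ψ, ⟨hψ, hψf⟩, -⟩ := freeAbelianTopGroup_existsUnique_lift X ℝ (fun y => 1 - (f y : ℝ))
    (continuous_const.sub (continuous_subtype_val.comp hf))
  have key : ∀ d : X →₀ ℤ,
      ψ (Finsupp.toFreeAbelianGroup d) = d.sum fun y n => n * (1 - (f y : ℝ)) := by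
    intro d
    induction d using Finsupp.induction_linear with
    | zero => simp
    | add d e hd he =>
      rw [map_add, map_add, hd, he, Finsupp.sum_add_index'] <;> intros <;> push_cast <;> ring
    | single y n => simp [Finsupp.toFreeAbelianGroup, hψf, Finsupp.sum_single_index]
  have hne : ψ (a - b) ≠ 0 := by
    have h := key c
    rw [hc, Finsupp.toFreeAbelianGroup_toFinsupp, ← hc] at h
    rw [h, Finsupp.sum, Finset.sum_eq_single x]
    · simpa [hfx] using hx
    · intro y hy hyx
      have h1 := hfs (show y ∈ ((c.support.erase x : Finset X) : Set X) by
        simpa [hyx] using hy)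
      simp [h1]
    · intro h
      have h0 : c x = 0 := by simpa using h
      simp [h0]
  exact separated_by_continuous hψ fun h => hne (by rw [map_sub, h, sub_self])

/-- The free abelian topological group is generated by `X`. -/
theorem closure_range_freeAbelianGroup_of (X : Type u) [TopologicalSpace X] :
    AddSubgroup.closure (Set.range (FreeAbelianGroup.of : X → FreeAbelianTopGroup X)) = ⊤ := by
  refine top_unique fun a _ => ?_
  induction a using FreeAbelianGroup.induction_on with
  | zero => exact zero_mem _
  | of x => exact AddSubgroup.subset_closure ⟨x, rfl⟩
  | neg x h => exact neg_mem (h trivial)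
  | add x y hx hy => exact add_mem (hx trivial) (hy trivial)

/-- A topological group `G` (written additively) is `o`-bounded if for every sequence `U n` of
nonempty open sets there are finite sets `F n` with `G = ⋃ n, F n + U n`. -/
def OBounded (G : Type u) [AddGroup G] [TopologicalSpace G] : Prop :=
  ∀ U : ℕ → Set G, (∀ n, IsOpen (U n) ∧ (U n).Nonempty) →
    ∃ F : ℕ → Set G, (∀ n, (F n).Finite) ∧ ⋃ n, (F n + U n) = Set.univ

/-! ### Multicovered spaces -/

/-- A multicover of a set `X` is a family of covers of `X`. -/
structure Multicover (X : Type u) where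
  /-- The members of the multicover. -/
  covers : Set (Set (Set X))
  /-- Each member covers the whole set. -/
  sUnion_eq : ∀ c ∈ covers, ⋃₀ c = Set.univ

/-- A set `B` is `c`-bounded if it is contained in the union of a finite subfamily of `c`. -/
def CoverBounded {X : Type u} (c : Set (Set X)) (B : Set X) : Prop :=
  ∃ d : Set (Set X), d ⊆ c ∧ d.Finite ∧ B ⊆ ⋃₀ d

/-- A sequence of subsets is an `ω`-cover if every finite subset lies in one of its members. -/
def IsOmegaCover {X : Type u} (B : ℕ → Set X) : Prop :=
  ∀ F : Set X, F.Finite → ∃ n, F ⊆ B n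

/-- The Scheepers property of the multicovered space `(X, L)`. -/
def Multicover.Scheepers {X : Type u} (L : Multicover X) : Prop :=
  ∀ c : ℕ → Set (Set X), (∀ n, c n ∈ L.covers) →
    ∃ B : ℕ → Set X, (∀ n, CoverBounded (c n) (B n)) ∧ IsOmegaCover B

/-- The multicover of a uniform space consisting of the uniform covers `{U(x) : x ∈ X}`, where `U`
is an entourage and `U(x) = {y | (x, y) ∈ U}`. -/
def uniformMulticover {X : Type u} (𝒰 : UniformSpace X) : Multicover X where
  covers := {c | ∃ U ∈ 𝓤[𝒰], c = Set.range fun x : X => {y : X | (x, y) ∈ U}}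
  sUnion_eq := by
    rintro c ⟨U, hU, rfl⟩
    refine Set.eq_univ_of_forall fun x => ⟨_, ⟨x, rfl⟩, ?_⟩
    exact @refl_mem_uniformity X 𝒰 x U hU

/-- The universal uniformity `𝒰(X)` of a Tychonoff space: the finest uniformity that generates the
topology of `X`. -/
@[reducible] def universalUniformity (X : Type u) [t : TopologicalSpace X] : UniformSpace X :=
  sInf {𝒰 : UniformSpace X | 𝒰.toTopologicalSpace = t}

/-- On a Tychonoff space the universal uniformity generates the topology and contains all the
uniformities that do (in Mathlib's order, finer uniformities are smaller). -/
theorem isLeast_universalUniformity (X : Type u) [t : TopologicalSpace X] [T35Space X] :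
    IsLeast {𝒰 : UniformSpace X | 𝒰.toTopologicalSpace = t} (universalUniformity X) := by
  refine ⟨?_, fun 𝒰 h𝒰 => sInf_le h𝒰⟩
  obtain ⟨𝒰, h𝒰⟩ := CompletelyRegularSpace.exists_uniformSpace (X := X)
  change (sInf _ : UniformSpace X).toTopologicalSpace = t
  rw [UniformSpace.toTopologicalSpace_sInf]
  refine le_antisymm ((iInf₂_le 𝒰 h𝒰).trans h𝒰.le) (le_iInf₂ fun 𝒱 h𝒱 => ?_)
  exact (show 𝒱.toTopologicalSpace = t from h𝒱).ge

/-! ### Pseudometrics subordinate to an entourage -/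

/-! Both directions compare finite subsets of `X` with words in `A(X)`. If `A(X)` is `o`-bounded, a
finite set is coded by the sum of its points. By `FreeAbelianGroup.exists_nhds_zero_support`, a word
close enough to this sum has, for each point of the set, a letter near it, so the supports of the
finite sets `F n` supply finitely many centres. Conversely, a word with `l` letters is approximated
letter by letter by words over finitely many centres. The errors add up `l` times, so the entourage
must depend on `l`; the indices are therefore split into infinitely many infinite classes, one per
length, and the Scheepers property is used on each. -/

/-- Every entourage of a uniform space is an entourage of some coarser pseudometric. -/
theorem UniformSpace.exists_pseudoMetricSpace_le {X : Type u} (𝒰 : UniformSpace X)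
    {U : Set (X × X)} (hU : U ∈ 𝓤[𝒰]) :
    ∃ I : PseudoMetricSpace X, 𝒰 ≤ I.toUniformSpace ∧ U ∈ 𝓤[I.toUniformSpace] := by
  have step : ∀ s : {s : SetRel X X // s ∈ 𝓤 X}, ∃ t : {s : SetRel X X // s ∈ 𝓤 X},
      SetRel.IsSymm t.1 ∧ t.1.comp t.1 ⊆ s.1 := fun s => by
    obtain ⟨t, ht, hts, htc⟩ := comp_symm_mem_uniformity_sets s.2
    exact ⟨⟨t, ht⟩, hts, htc⟩
  choose half half_symm half_comp using step
  -- The exponent `n + 1` makes even `V 0` symmetric, as `U` itself need not be. The `V n` generate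
  -- a countably based uniformity, hence a pseudometrizable one.
  let V : ℕ → {s : SetRel X X // s ∈ 𝓤 X} := fun n => half^[n + 1] ⟨U, hU⟩
  have V_succ : ∀ n, V (n + 1) = half (V n) := fun n => Function.iterate_succ_apply' _ _ _
  have V_symm : ∀ n, SetRel.IsSymm (V n).1 := fun n => by
    rw [show V n = half (half^[n] ⟨U, hU⟩) from Function.iterate_succ_apply' _ _ _]
    exact half_symm _
  have half_sub : ∀ s, (half s).1 ⊆ s.1 := fun s p hp =>
    half_comp s ⟨p.2, hp, refl_mem_uniformity (half s).2⟩
  have V_anti : Antitone fun n => (V n).1 :=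
    antitone_nat_of_succ_le fun n => by rw [V_succ]; exact half_sub _
  have basis : (⨅ n, Filter.principal (V n).1).HasBasis (fun _ : ℕ => True) fun n => (V n).1 :=
    Filter.hasBasis_iInf_principal V_anti.directed_ge
  let core : UniformSpace.Core X :=
    { uniformity := ⨅ n, Filter.principal (V n).1
      refl := le_iInf fun n => Filter.principal_mono.2 fun p hp => by
        obtain ⟨x, y⟩ := p
        obtain rfl : x = y := hp
        exact refl_mem_uniformity (V n).2
      symm := (basis.tendsto_iff basis).2 fun n _ =>
        ⟨n, trivial, fun p hp => (V_symm n).symm _ _ hp⟩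
      comp := by
        refine basis.ge_iff.2 fun n _ => ?_
        refine Filter.mem_of_superset
          (Filter.mem_lift' (basis.mem_of_mem (i := n + 1) trivial)) ?_
        rw [V_succ]
        exact half_comp _ }
  let 𝒱 : UniformSpace X := UniformSpace.ofCore core
  have hgen : (𝓤[𝒱]).IsCountablyGenerated := basis.isCountablyGenerated
  refine ⟨@UniformSpace.pseudoMetricSpace X 𝒱 hgen, ?_, ?_⟩
  · exact le_iInf fun n => Filter.le_principal_iff.2 (V n).2
  · exact Filter.mem_of_superset (basis.mem_of_mem (i := 0) trivial) (half_sub _)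

/-! ### Neighbourhoods of zero in the free abelian topological group -/

/-- Every entourage of a uniformity coarser than the topology of `X` gives a neighbourhood `W` of
zero in `A(X)` such that a set of points whose sum is `W`-close to `f` is contained in the union of
the balls around the support of `f`. -/
theorem FreeAbelianGroup.exists_nhds_zero_support {X : Type u} [t : TopologicalSpace X]
    (𝒰 : UniformSpace X) (h𝒰 : t ≤ 𝒰.toTopologicalSpace) {U : Set (X × X)} (hU : U ∈ 𝓤[𝒰]) :
    ∃ W : Set (FreeAbelianTopGroup X), IsOpen W ∧ 0 ∈ W ∧
      ∀ (s : Finset X) (f : FreeAbelianTopGroup X), ∑ x ∈ s, FreeAbelianGroup.of x - f ∈ W →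
        ∀ x ∈ s, ∃ y ∈ f.support, (y, x) ∈ U := by
  obtain ⟨I, hI, hIU⟩ := 𝒰.exists_pseudoMetricSpace_le hU
  obtain ⟨r, hr, hrU⟩ := Metric.mem_uniformity_dist.1 hIU
  -- A tent of height 1 and radius `r` centred at `x`. The map `x ↦ φ x` is `1/r`-Lipschitz for the
  -- sup distance, so it extends to `A(X)` with values in functions under uniform convergence;
  -- uniformity lets one `W` serve all evaluation points.
  let φ : X → X → ℝ := fun x z => max 0 (1 - dist x z / r)
  have hφ : Continuous fun x => UniformFun.ofFun (φ x) := by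
    refine continuous_iff_continuousAt.2 fun x => ?_
    rw [ContinuousAt, (UniformFun.hasBasis_nhds_of_basis X ℝ _
      Metric.uniformity_basis_dist).tendsto_right_iff]
    intro ε hε
    have h1 : Metric.ball x (ε * r) ∈ 𝓝 x :=
      nhds_mono (h𝒰.trans (UniformSpace.toTopologicalSpace_mono hI))
        (Metric.ball_mem_nhds x (mul_pos hε hr))
    filter_upwards [h1] with y hy z
    have h2 : |dist x z - dist y z| ≤ dist x y := abs_dist_sub_le x y z
    rw [Metric.mem_ball, dist_comm] at hy
    change dist (φ x z) (φ y z) < ε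
    rw [Real.dist_eq]
    calc |φ x z - φ y z| ≤ |(1 - dist x z / r) - (1 - dist y z / r)| := by
          simpa [φ, max_comm] using abs_max_sub_max_le_abs (1 - dist x z / r) (1 - dist y z / r) 0
      _ = |dist x z - dist y z| / r := by
          rw [← abs_of_pos hr, ← abs_div, abs_of_pos hr, ← abs_neg]; ring_nf
      _ < ε := (div_lt_iff₀ hr).2 (h2.trans_lt hy)
  obtain ⟨ψ, ⟨hψ, hψφ⟩, -⟩ := freeAbelianTopGroup_existsUnique_lift X (UniformFun X ℝ) _ hφ
  let ev : X → FreeAbelianGroup X →+ ℝ := fun z =>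
    { toFun := fun g => UniformFun.toFun (ψ g) z
      map_zero' := by simp
      map_add' := fun a b => by simp }
  have ev_of : ∀ z x, ev z (FreeAbelianGroup.of x) = φ x z := fun z x => by
    change UniformFun.toFun (ψ _) z = _
    rw [hψφ]; rfl
  have ev_eq : ∀ z g, ev z g = g.toFinsupp.sum fun y n => n * φ y z := fun z g => by
    induction g using FreeAbelianGroup.induction_on with
    | zero => simp
    | of x => simp [ev_of]
    | neg x h => simp [ev_of, Finsupp.sum_neg_index]
    | add a b ha hb =>
      rw [map_add, map_add, ha, hb, Finsupp.sum_add_index'] <;> intros <;> push_cast <;> ring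
  have hN : {g : UniformFun X ℝ | ∀ z, (0, UniformFun.toFun g z) ∈ {p : ℝ × ℝ | dist p.1 p.2 < 1}} ∈
      𝓝 (0 : UniformFun X ℝ) :=
    (UniformFun.hasBasis_nhds_of_basis X ℝ _ Metric.uniformity_basis_dist).mem_of_mem one_pos
  refine ⟨interior (ψ ⁻¹' _), isOpen_interior,
    mem_interior_iff_mem_nhds.2 (hψ.continuousAt.preimage_mem_nhds (by rwa [map_zero])), ?_⟩
  intro s f hsf x hx
  by_contra! hne
  -- Evaluation at a point `x` of `s` far from the support of `f` kills `f`. The sum over `s` takes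
  -- a value at least `φ x x = 1`, since tents are nonnegative and cannot cancel.
  have h1 : dist 0 (ev x (∑ y ∈ s, FreeAbelianGroup.of y - f)) < 1 := interior_subset hsf x
  have hf : ev x f = 0 := by
    rw [ev_eq]
    refine Finset.sum_eq_zero fun y hy => ?_
    have hd : r ≤ dist y x := not_lt.1 fun h => hne y hy (hrU h)
    have : φ y x = 0 := max_eq_left (sub_nonpos.2 ((one_le_div₀ hr).2 hd))
    simp [this]
  have hs : 1 ≤ ev x (∑ y ∈ s, FreeAbelianGroup.of y) := by
    rw [map_sum]
    calc (1 : ℝ) = ev x (FreeAbelianGroup.of x) := by simp [ev_of, φ]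
      _ ≤ _ := Finset.single_le_sum (f := fun y => ev x (FreeAbelianGroup.of y))
        (fun y _ => by rw [ev_of]; exact le_max_left _ _) hx
  rw [map_sub, hf, sub_zero, dist_comm, Real.dist_eq, sub_zero] at h1
  exact absurd (le_abs_self _) (not_le.2 (h1.trans_le hs))

/-- In a topological group every neighbourhood of zero contains the sums of `n` elements of some
neighbourhood of zero. -/
theorem exists_nhds_zero_nsmul_subset {G : Type u} [AddCommGroup G] [TopologicalSpace G]
    [IsTopologicalAddGroup G] {W : Set G} (hW : W ∈ 𝓝 (0 : G)) (n : ℕ) :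
    ∃ V ∈ 𝓝 (0 : G), n • V ⊆ W := by
  induction n generalizing W with
  | zero => exact ⟨W, hW, by simpa using mem_of_mem_nhds hW⟩
  | succ n ih =>
    obtain ⟨V, hV, hVW⟩ := exists_nhds_zero_half hW
    obtain ⟨V', hV', hnV⟩ := ih hV
    refine ⟨V ∩ V', Filter.inter_mem hV hV', ?_⟩
    rw [succ_nsmul]
    rintro _ ⟨a, ha, b, hb, rfl⟩
    exact hVW a (hnV (Set.nsmul_subset_nsmul_left Set.inter_subset_right ha)) b hb.1

/-- The set of elements of the form `0`, `x` or `-x` with `x ∈ s` in the free abelian group. -/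
def FreeAbelianGroup.signed {X : Type u} (s : Set X) : Set (FreeAbelianGroup X) :=
  {0} ∪ FreeAbelianGroup.of '' s ∪ -(FreeAbelianGroup.of '' s)

theorem FreeAbelianGroup.signed_mono {X : Type u} {s t : Set X} (h : s ⊆ t) :
    FreeAbelianGroup.signed s ⊆ FreeAbelianGroup.signed t :=
  Set.union_subset_union (Set.union_subset_union_right _ (Set.image_mono h))
    (Set.neg_subset_neg.2 (Set.image_mono h))

theorem FreeAbelianGroup.zero_mem_signed {X : Type u} (s : Set X) :
    0 ∈ FreeAbelianGroup.signed s := Or.inl (Or.inl rfl)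

theorem FreeAbelianGroup.finite_signed {X : Type u} {s : Set X} (hs : s.Finite) :
    (FreeAbelianGroup.signed s).Finite :=
  ((Set.finite_singleton _).union (hs.image _)).union (hs.image _).neg

theorem FreeAbelianGroup.exists_mem_nsmul_signed {X : Type u} (g : FreeAbelianGroup X) :
    ∃ (n : ℕ) (s : Set X), s.Finite ∧ g ∈ n • FreeAbelianGroup.signed s := by
  induction g using FreeAbelianGroup.induction_on with
  | zero => exact ⟨0, ∅, Set.finite_empty, by simp⟩
  | of x => exact ⟨1, {x}, Set.finite_singleton x, by simp [FreeAbelianGroup.signed]⟩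
  | neg x _ => exact ⟨1, {x}, Set.finite_singleton x, by simp [FreeAbelianGroup.signed]⟩
  | add a b ha hb =>
    obtain ⟨m, s, hs, ha⟩ := ha
    obtain ⟨n, t, ht, hb⟩ := hb
    refine ⟨m + n, s ∪ t, hs.union ht, ?_⟩
    rw [add_nsmul]
    exact Set.add_mem_add
      (Set.nsmul_subset_nsmul_left (FreeAbelianGroup.signed_mono Set.subset_union_left) ha)
      (Set.nsmul_subset_nsmul_left (FreeAbelianGroup.signed_mono Set.subset_union_right) hb)

/-- A neighbourhood of zero in `A(X)` induces an entourage of the universal uniformity. -/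
theorem mem_uniformity_universalUniformity_of_mem_nhds (X : Type u) [TopologicalSpace X]
    [T35Space X] {V : Set (FreeAbelianTopGroup X)} (hV : V ∈ 𝓝 0) :
    {p : X × X | FreeAbelianGroup.of p.2 - FreeAbelianGroup.of p.1 ∈ V} ∈
      𝓤[universalUniformity X] := by
  let 𝒢 : UniformSpace (FreeAbelianTopGroup X) :=
    IsTopologicalAddGroup.rightUniformSpace (FreeAbelianTopGroup X)
  let 𝒱 : UniformSpace X := 𝒢.comap FreeAbelianGroup.of
  -- The group uniformity pulled back to `X` generates the topology of `X`, because `X` embeds in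
  -- `A(X)`.
  have hle : universalUniformity X ≤ 𝒱 :=
    (isLeast_universalUniformity X).2 (isEmbedding_freeAbelianGroup_of X).eq_induced.symm
  refine hle (Filter.mem_comap.2 ⟨{p | p.2 - p.1 ∈ V}, ?_, fun p hp => hp⟩)
  change _ ∈ Filter.comap _ _
  exact Filter.mem_comap.2 ⟨V, hV, fun p hp => by simpa [sub_eq_add_neg] using hp⟩

/-! ### The two implications -/

theorem OBounded.scheepers_uniformMulticover {X : Type u} [t : TopologicalSpace X]
    (h : OBounded (FreeAbelianTopGroup X)) (𝒰 : UniformSpace X) (h𝒰 : t ≤ 𝒰.toTopologicalSpace) :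
    (uniformMulticover 𝒰).Scheepers := by
  intro c hc
  choose U hU hcU using hc
  choose W hWo hW0 hW using fun n => FreeAbelianGroup.exists_nhds_zero_support 𝒰 h𝒰 (hU n)
  obtain ⟨F, hF, hcov⟩ := h W fun n => ⟨hWo n, 0, hW0 n⟩
  let D : ℕ → Set X := fun n => ⋃ f ∈ F n, (f.support : Set X)
  have hD : ∀ n, (D n).Finite := fun n => (hF n).biUnion fun f _ => f.support.finite_toSet
  refine ⟨fun n => ⋃ y ∈ D n, {x | (y, x) ∈ U n}, fun n => ?_, fun S hS => ?_⟩
  · refine ⟨(fun y => {x | (y, x) ∈ U n}) '' D n, ?_, (hD n).image _, ?_⟩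
    · rw [hcU n]
      exact Set.image_subset_range _ _
    · rw [Set.sUnion_image]
  · obtain ⟨n, hn⟩ := Set.mem_iUnion.1
      (hcov.ge (Set.mem_univ (∑ x ∈ hS.toFinset, FreeAbelianGroup.of x)))
    obtain ⟨f, hf, w, hw, hfw⟩ := hn
    refine ⟨n, fun x hx => ?_⟩
    obtain ⟨y, hy, hyx⟩ := hW n hS.toFinset f (by rw [← hfw]; simpa using hw) x (by simpa using hx)
    exact Set.mem_biUnion (Set.mem_biUnion hf hy) hyx

theorem oBounded_of_scheepers_universalUniformity {X : Type u} [TopologicalSpace X] [T35Space X]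
    (h : (uniformMulticover (universalUniformity X)).Scheepers) :
    OBounded (FreeAbelianTopGroup X) := by
  intro O hO
  choose g hg using fun n => (hO n).2
  have hW : ∀ n, (fun w => g n + w) ⁻¹' O n ∈ 𝓝 (0 : FreeAbelianTopGroup X) := fun n =>
    ((hO n).1.preimage (continuous_const_add (g n))).mem_nhds (by simpa using hg n)
  choose V hV hVW using fun n l => exists_nhds_zero_nsmul_subset (hW n) l
  -- Intersecting with `-V n l` controls the error of a letter `-x` as well as that of `x`.
  let E : ℕ → ℕ → Set (X × X) := fun n l =>
    {p | FreeAbelianGroup.of p.2 - FreeAbelianGroup.of p.1 ∈ V n l ∩ -V n l}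
  have hE : ∀ n l, E n l ∈ 𝓤[universalUniformity X] := fun n l =>
    mem_uniformity_universalUniformity_of_mem_nhds X
      (Filter.inter_mem (hV n l) (neg_mem_nhds_zero _ (hV n l)))
  -- The indices `Nat.pair l k`, with `k` varying, are reserved for words of length `l`.
  choose B hB hBω using fun l : ℕ =>
    h (fun k => Set.range fun x => {y | (x, y) ∈ E (Nat.pair l k) l}) fun k => ⟨_, hE _ l, rfl⟩
  have hD : ∀ l k, ∃ D : Set X, D.Finite ∧ ∀ x ∈ B l k, ∃ y ∈ D, (y, x) ∈ E (Nat.pair l k) l := by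
    intro l k
    obtain ⟨d, hd, hdf, hBd⟩ := hB l k
    obtain ⟨D, -, hDf, rfl⟩ := Set.exists_subset_image_finite_and.1
      ⟨d, by rwa [Set.image_univ], hdf, rfl⟩
    refine ⟨D, hDf, fun x hx => ?_⟩
    obtain ⟨_, ⟨y, hy, rfl⟩, hyx⟩ := hBd hx
    exact ⟨y, hy, hyx⟩
  choose D hDf hBD using hD
  have key : ∀ l k, FreeAbelianGroup.signed (B l k) ⊆
      FreeAbelianGroup.signed (D l k) + V (Nat.pair l k) l := by
    rintro l k a ((rfl | ⟨x, hx, rfl⟩) | ⟨x, hx, hxa⟩)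
    · exact ⟨0, FreeAbelianGroup.zero_mem_signed _, 0, mem_of_mem_nhds (hV _ _), add_zero 0⟩
    · obtain ⟨y, hy, hyx⟩ := hBD l k x hx
      exact ⟨_, Or.inl (Or.inr ⟨y, hy, rfl⟩), _, hyx.1, add_sub_cancel _ _⟩
    · obtain ⟨y, hy, hyx⟩ := hBD l k x hx
      refine ⟨-FreeAbelianGroup.of y, Or.inr (Set.neg_mem_neg.2 ⟨y, hy, rfl⟩), _, hyx.2, ?_⟩
      rw [← neg_neg a, ← hxa]
      simp [sub_eq_add_neg]
  -- The multiple is an `l`-fold sumset, with `l = n.unpair.1`. The shift by `-g n` compensates for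
  -- `O n` being a neighbourhood of `g n` instead of zero.
  refine ⟨fun n => (n.unpair.1 • FreeAbelianGroup.signed (D n.unpair.1 n.unpair.2)) + {-g n},
    fun n => ?_, Set.eq_univ_of_forall fun a => ?_⟩
  · have hfin : ∀ (S : Set (FreeAbelianGroup X)), S.Finite → ∀ m : ℕ, (m • S).Finite := by
      intro S hS m
      induction m with
      | zero => simp
      | succ m ih => rw [succ_nsmul]; exact ih.add hS
    exact (hfin _ (FreeAbelianGroup.finite_signed (hDf _ _)) _).add (Set.finite_singleton _)
  · obtain ⟨l, s, hs, ha⟩ := FreeAbelianGroup.exists_mem_nsmul_signed a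
    obtain ⟨k, hk⟩ := hBω l s hs
    have h1 := Set.nsmul_subset_nsmul_left (n := l)
      ((FreeAbelianGroup.signed_mono hk).trans (key l k)) ha
    -- Commutativity gathers the `l` centres into `b` and the `l` errors into `v`.
    rw [nsmul_add] at h1
    obtain ⟨b, hb, v, hv, rfl⟩ := h1
    refine Set.mem_iUnion.2 ⟨Nat.pair l k, b + -g (Nat.pair l k), ?_, g (Nat.pair l k) + v,
      hVW _ _ hv, by simp [add_assoc]⟩
    exact ⟨b, by simpa using hb, _, rfl, rfl⟩

theorem theorem3 (X : Type u) [TopologicalSpace X] [T35Space X] :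
    OBounded (FreeAbelianTopGroup X) ↔
      (uniformMulticover (universalUniformity X)).Scheepers :=
  ⟨fun h => h.scheepers_uniformMulticover _ (isLeast_universalUniformity X).1.ge,
    oBounded_of_scheepers_universalUniformity⟩
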